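/- Let $A=\mathbb{Z}[\tfrac13,\omega]/(1+\omega+\omega^2)$ and $B=A[\nu,(\nu^3-1)^{-1}]$, and let $C$ be the plane projective cubic curve over $S=\operatorname{Spec}(B)$ given by $$y^2z+3\nu\,xyz+(\nu^3-1)\,yz^2=x^3,$$ with origin $O=[0:1:0]$. Let $S''\subset S$ be the closed subscheme where $2=\nu=0$, and let $C''=C\times_S S''$. Then $S''=\operatorname{Spec}(B/(2,\nu))$ and $B/(2,\nu)$ is a field with four elements. The curve $C''$ is a supersingular elliptic curve over $\mathbb{F}_4$: it has no point of order $2$ over an algebraic closure $\overline{\mathbb{F}}_4$ and, equivalently, its formal group has height $2$. More precisely, put $y=1$ and let $z(x)\in\mathbb{F}_4[[x]]$ be the unique power series without constant term for which $[x:1:z(x)]$ lies on $C''$. There is exactly one formal group law $F(x_0,x_1)\in\mathbb{F}_4[[x_0,x_1]]$ such that $$[x_0:1:z(x_0)]+[x_1:1:z(x_1)]=[F:1:z(F)]$$ in the group of points of $C''$ over the fraction field of $\mathbb{F}_4[[x_0,x_1]]$; this $F$ is the formal group law of $C''$ at $O$ with respect to the formal parameter $x$. It has height $2$, that is, its multiplication-by-two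 series has the form $[2](x)=g(x^4)$ for some $g\in\mathbb{F}_4[[x]]$ with $g(0)=0$ and $g'(0)\neq 0$. Moreover $$[2](x)=x^4+O(x^5).$$ -/

import Mathlib

/-! ### The curve and its fibre -/

/-- `A = ℤ[1/3, ω]/(1 + ω + ω²)`, the ring of functions on the scheme of primitive cube roots
of unity over `Spec ℤ[1/3]`. -/
noncomputable abbrev CubeRootRing : Type :=
  AdjoinRoot (1 + Polynomial.X + Polynomial.X ^ 2 : Polynomial (Localization.Away (3 : ℤ)))

/-- `B = A[ν, (ν³ - 1)⁻¹] = ℤ[1/3, ω, ν, (ν³ - 1)⁻¹]/(1 + ω + ω²)`, the ring of functions on the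
base scheme `S`. -/
noncomputable abbrev LevelThreeBase : Type :=
  Localization.Away ((Polynomial.X : Polynomial CubeRootRing) ^ 3 - 1)

/-- The coordinate `ν` in `B`. -/
noncomputable def levelThreeNu : LevelThreeBase :=
  algebraMap (Polynomial CubeRootRing) LevelThreeBase Polynomial.X

/-- The plane cubic `C : y² + 3ν x y + (ν³ - 1) y = x³` over `B`. -/
noncomputable def levelThreeCurve : WeierstrassCurve LevelThreeBase where
  a₁ := 3 * levelThreeNu
  a₂ := 0
  a₃ := levelThreeNu ^ 3 - 1
  a₄ := 0
  a₆ := 0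

/-- The ring `B/(2, ν)` of functions on the closed subscheme `S''` of `S` where `2 = ν = 0`. -/
noncomputable abbrev SpecialFibreBase : Type :=
  LevelThreeBase ⧸ (Ideal.span {2, levelThreeNu} : Ideal LevelThreeBase)

/-- The fibre `C''` of `C` over `S''`. -/
noncomputable def specialFibreCurve : WeierstrassCurve SpecialFibreBase :=
  levelThreeCurve.map (Ideal.Quotient.mk (Ideal.span {2, levelThreeNu}))

/-! ### The formal group of a Weierstrass curve

In the chart `y = 1` around the origin `[0 : 1 : 0]`, a Weierstrass curve has the equation
`z + a₁ x z + a₃ z² = x³ + a₂ x² z + a₄ x z² + a₆ z³`, and `x` is a formal parameter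
at the origin. -/

namespace WeierstrassCurve

section Expansion

variable {R : Type*} [CommRing R]

/-- The operator `f ↦ x³ + a₂ x² f + a₄ x f² + a₆ f³ - a₁ x f - a₃ f²` on power series in `x`, whose
fixed points are the solutions `z = f(x)` of the equation in the chart `y = 1`. -/
noncomputable def chartStep (W : WeierstrassCurve R) (f : PowerSeries R) : PowerSeries R :=
  PowerSeries.X ^ 3 + PowerSeries.C W.a₂ * PowerSeries.X ^ 2 * f
    + PowerSeries.C W.a₄ * PowerSeries.X * f ^ 2 + PowerSeries.C W.a₆ * f ^ 3
    - PowerSeries.C W.a₁ * PowerSeries.X * f - PowerSeries.C W.a₃ * f ^ 2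

/-- The expansion `z = z(x)` at the origin in the formal parameter `x`: the limit of the
iterates of `chartStep` starting from `0`. It is the unique power series without constant term
that satisfies the equation of the curve in the chart `y = 1`, by `chartStep_zExpansion` and
`eq_zExpansion` below. -/
noncomputable def zExpansion (W : WeierstrassCurve R) : PowerSeries R :=
  PowerSeries.mk fun n => PowerSeries.coeff n (W.chartStep^[n] 0)

theorem X_dvd_chartStep (W : WeierstrassCurve R) {f : PowerSeries R} (hf : PowerSeries.X ∣ f) :
    PowerSeries.X ∣ W.chartStep f := by
  obtain ⟨g, rfl⟩ := hf
  refine ⟨PowerSeries.X ^ 2 + PowerSeries.C W.a₂ * PowerSeries.X ^ 2 * g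
    + PowerSeries.C W.a₄ * PowerSeries.X ^ 2 * g ^ 2
    + PowerSeries.C W.a₆ * PowerSeries.X ^ 2 * g ^ 3
    - PowerSeries.C W.a₁ * PowerSeries.X * g - PowerSeries.C W.a₃ * PowerSeries.X * g ^ 2, ?_⟩
  rw [chartStep]
  ring

theorem dvd_chartStep_sub (W : WeierstrassCurve R) {f g : PowerSeries R} {n : ℕ}
    (hf : PowerSeries.X ∣ f) (hg : PowerSeries.X ∣ g) (h : PowerSeries.X ^ n ∣ f - g) :
    PowerSeries.X ^ (n + 1) ∣ W.chartStep f - W.chartStep g := by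
  obtain ⟨f, rfl⟩ := hf
  obtain ⟨g, rfl⟩ := hg
  obtain ⟨d, hd⟩ := h
  refine ⟨d * (PowerSeries.C W.a₂ * PowerSeries.X + PowerSeries.C W.a₄ * PowerSeries.X * (f + g)
    + PowerSeries.C W.a₆ * PowerSeries.X * (f ^ 2 + f * g + g ^ 2)
    - PowerSeries.C W.a₁ - PowerSeries.C W.a₃ * (f + g)), ?_⟩
  rw [chartStep, chartStep]
  linear_combination (PowerSeries.C W.a₂ * PowerSeries.X ^ 2
    + PowerSeries.C W.a₄ * PowerSeries.X ^ 2 * (f + g)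
    + PowerSeries.C W.a₆ * PowerSeries.X ^ 2 * (f ^ 2 + f * g + g ^ 2)
    - PowerSeries.C W.a₁ * PowerSeries.X - PowerSeries.C W.a₃ * PowerSeries.X * (f + g)) * hd

theorem X_dvd_iterate_chartStep (W : WeierstrassCurve R) (n : ℕ) :
    PowerSeries.X ∣ W.chartStep^[n] 0 := by
  induction n with
  | zero => simp
  | succ n ih =>
    rw [Function.iterate_succ_apply']
    exact W.X_dvd_chartStep ih

theorem dvd_iterate_chartStep_sub (W : WeierstrassCurve R) (n k : ℕ) :
    PowerSeries.X ^ (n + 1) ∣ W.chartStep^[n + k] 0 - W.chartStep^[n] 0 := by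
  induction n with
  | zero => simpa using W.X_dvd_iterate_chartStep k
  | succ n ih =>
    rw [Nat.add_right_comm n 1 k, Function.iterate_succ_apply', Function.iterate_succ_apply']
    exact W.dvd_chartStep_sub (W.X_dvd_iterate_chartStep _) (W.X_dvd_iterate_chartStep _) ih

theorem dvd_zExpansion_sub (W : WeierstrassCurve R) (n : ℕ) :
    PowerSeries.X ^ (n + 1) ∣ W.zExpansion - W.chartStep^[n] 0 := by
  rw [PowerSeries.X_pow_dvd_iff]
  intro m hm
  obtain ⟨k, rfl⟩ := Nat.exists_eq_add_of_le (Nat.lt_succ_iff.mp hm)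
  have h := PowerSeries.X_pow_dvd_iff.mp (W.dvd_iterate_chartStep_sub m k) m (Nat.lt_succ_self m)
  rw [map_sub, sub_eq_zero] at h ⊢
  rw [h, zExpansion, PowerSeries.coeff_mk]

theorem X_dvd_zExpansion (W : WeierstrassCurve R) : PowerSeries.X ∣ W.zExpansion := by
  simpa using W.dvd_zExpansion_sub 0

theorem constantCoeff_zExpansion (W : WeierstrassCurve R) :
    PowerSeries.constantCoeff W.zExpansion = 0 :=
  PowerSeries.X_dvd_iff.mp W.X_dvd_zExpansion

theorem eq_of_forall_X_pow_dvd_sub {f g : PowerSeries R}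
    (h : ∀ n : ℕ, PowerSeries.X ^ (n + 1) ∣ f - g) : f = g := by
  ext n
  have hn := PowerSeries.X_pow_dvd_iff.mp (h n) n (Nat.lt_succ_self n)
  rwa [map_sub, sub_eq_zero] at hn

theorem chartStep_zExpansion (W : WeierstrassCurve R) :
    W.chartStep W.zExpansion = W.zExpansion := by
  refine eq_of_forall_X_pow_dvd_sub fun n => ?_
  have h₁ := W.dvd_chartStep_sub W.X_dvd_zExpansion (W.X_dvd_iterate_chartStep n)
    (W.dvd_zExpansion_sub n)
  rw [← Function.iterate_succ_apply' W.chartStep] at h₁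
  have h₂ := dvd_sub h₁ (W.dvd_zExpansion_sub (n + 1))
  rw [sub_sub_sub_cancel_right] at h₂
  exact (pow_dvd_pow _ (Nat.le_succ _)).trans h₂

theorem eq_zExpansion (W : WeierstrassCurve R) {f : PowerSeries R}
    (hf : PowerSeries.constantCoeff f = 0) (h : W.chartStep f = f) : f = W.zExpansion := by
  refine eq_of_forall_X_pow_dvd_sub fun n => ?_
  induction n with
  | zero => simpa using dvd_sub (PowerSeries.X_dvd_iff.mpr hf) W.X_dvd_zExpansion
  | succ n ih =>
    have := W.dvd_chartStep_sub (PowerSeries.X_dvd_iff.mpr hf) W.X_dvd_zExpansion ih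
    rwa [h, chartStep_zExpansion] at this

end Expansion

section FormalPoint

variable {k : Type*} [Field k] {σ : Type*}

instance isDomain_mvPowerSeries (k : Type*) [Field k] (σ : Type*) :
    IsDomain (MvPowerSeries σ k) :=
  NoZeroDivisors.to_isDomain _

/-- The fraction field of the ring of power series over `k` in variables indexed by `σ`. -/
abbrev PowerSeriesFrac (k : Type*) [Field k] (σ : Type*) : Type _ :=
  FractionRing (MvPowerSeries σ k)

theorem subst_zExpansion (W : WeierstrassCurve k) {t : MvPowerSeries σ k}
    (ht : MvPowerSeries.constantCoeff t = 0) :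
    W.zExpansion.subst t = t ^ 3 + MvPowerSeries.C W.a₂ * t ^ 2 * W.zExpansion.subst t
      + MvPowerSeries.C W.a₄ * t * W.zExpansion.subst t ^ 2
      + MvPowerSeries.C W.a₆ * W.zExpansion.subst t ^ 3
      - MvPowerSeries.C W.a₁ * t * W.zExpansion.subst t
      - MvPowerSeries.C W.a₃ * W.zExpansion.subst t ^ 2 := by
  have hs : PowerSeries.HasSubst t := PowerSeries.HasSubst.of_constantCoeff_zero ht
  have h := congrArg (PowerSeries.substAlgHom (R := k) hs) W.chartStep_zExpansion
  simp only [chartStep, map_add, map_sub, map_mul, map_pow, PowerSeries.coe_substAlgHom,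
    PowerSeries.subst_X hs, PowerSeries.subst_C] at h
  exact h.symm

theorem nonsingular_formalPoint (W : WeierstrassCurve k) {t : MvPowerSeries σ k}
    (ht : MvPowerSeries.constantCoeff t = 0) :
    (W.baseChange (PowerSeriesFrac k σ)).toProjective.Nonsingular
      ![algebraMap _ (PowerSeriesFrac k σ) t, 1,
        algebraMap _ (PowerSeriesFrac k σ) (W.zExpansion.subst t)] := by
  have hC (a : k) : algebraMap k (PowerSeriesFrac k σ) a =
      algebraMap (MvPowerSeries σ k) (PowerSeriesFrac k σ) (MvPowerSeries.C a) :=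
    IsScalarTower.algebraMap_apply k (MvPowerSeries σ k) (PowerSeriesFrac k σ) a
  have hz : MvPowerSeries.constantCoeff (W.zExpansion.subst t) = 0 :=
    PowerSeries.constantCoeff_subst_eq_zero ht _ W.constantCoeff_zExpansion
  have h := congrArg (algebraMap _ (PowerSeriesFrac k σ)) (W.subst_zExpansion ht)
  rw [Projective.nonsingular_iff, Projective.equation_iff]
  refine ⟨?_, Or.inr (Or.inr ?_)⟩
  · simp only [baseChange, WeierstrassCurve.map_a₁, WeierstrassCurve.map_a₂,
      WeierstrassCurve.map_a₃, WeierstrassCurve.map_a₄, WeierstrassCurve.map_a₆, hC]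
    simp only [map_add, map_sub, map_mul, map_pow] at h
    simp
    linear_combination h
  · have hu : (1 + MvPowerSeries.C W.a₁ * t + 2 * MvPowerSeries.C W.a₃ * W.zExpansion.subst t
        - (MvPowerSeries.C W.a₂ * t ^ 2 + 2 * MvPowerSeries.C W.a₄ * t * W.zExpansion.subst t
          + 3 * MvPowerSeries.C W.a₆ * W.zExpansion.subst t ^ 2) : MvPowerSeries σ k) ≠ 0 := by
      intro h0
      simpa [ht, hz] using congrArg MvPowerSeries.constantCoeff h0
    simp only [baseChange, WeierstrassCurve.map_a₁, WeierstrassCurve.map_a₂,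
      WeierstrassCurve.map_a₃, WeierstrassCurve.map_a₄, WeierstrassCurve.map_a₆, hC]
    have := (map_ne_zero_iff _ (IsFractionRing.injective (MvPowerSeries σ k)
      (PowerSeriesFrac k σ))).mpr hu
    have h₂ : algebraMap (MvPowerSeries σ k) (PowerSeriesFrac k σ) 2 = 2 := map_ofNat _ 2
    have h₃ : algebraMap (MvPowerSeries σ k) (PowerSeriesFrac k σ) 3 = 3 := map_ofNat _ 3
    simpa [h₂, h₃] using this

/-- The point `[t : 1 : z(t)]` of `W` over the fraction field of the power series ring, for a power
series `t` without constant term. -/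
noncomputable def formalPoint (W : WeierstrassCurve k) (t : MvPowerSeries σ k)
    (ht : MvPowerSeries.constantCoeff t = 0) :
    (W.baseChange (PowerSeriesFrac k σ)).toProjective.Point :=
  ⟨(Projective.nonsingularLift_iff _).mpr (W.nonsingular_formalPoint ht)⟩

/-- `F` is the formal group law of `W` at the origin `[0 : 1 : 0]` with respect to the formal
parameter `x` (that is, `x / y` in homogeneous coordinates): in the group of points of `W` one has
`[x₀ : 1 : z(x₀)] + [x₁ : 1 : z(x₁)] = [F(x₀, x₁) : 1 : z(F(x₀, x₁))]`. -/
def IsFormalGroupLaw (W : WeierstrassCurve k) (F : FormalGroup k) : Prop :=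
  W.formalPoint (MvPowerSeries.X (0 : Fin 2)) (MvPowerSeries.constantCoeff_X 0)
      + W.formalPoint (MvPowerSeries.X (1 : Fin 2)) (MvPowerSeries.constantCoeff_X 1)
    = W.formalPoint F.toPowerSeries F.zero_constantCoeff

end FormalPoint

/-- Supersingularity over a field `k` of characteristic `p`, in terms of torsion: `W` is an elliptic
curve without nonzero points of order `p` over an algebraic closure of `k`. -/
def IsSupersingular {k : Type*} [Field k] (W : WeierstrassCurve k) (p : ℕ) [Fact p.Prime]
    [CharP k p] : Prop :=
  W.IsElliptic ∧
    ∀ P : (W.baseChange (AlgebraicClosure k)).toProjective.Point, p • P = 0 → P = 0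

end WeierstrassCurve

/-! ### Multiplication by `n` and height of a formal group law -/

namespace FormalGroup

variable {R : Type*} [CommRing R]

/-- The parameter `x`, as a point of the formal group with values in power series in `x`. -/
noncomputable def xPoint (F : FormalGroup R) : F.Point Unit :=
  ⟨PowerSeries.X, PowerSeries.HasSubst.X'⟩

/-- The power series `[n](x)`: the `n`-fold sum of `x` with itself under the formal group law. -/
noncomputable def nSeries (F : FormalGroup R) (n : ℕ) : PowerSeries R :=
  (n • F.xPoint).val

/-- A formal group law over a field of characteristic `p` has height `h` if
`[p](x) = g(x ^ (p ^ h))` for a power series `g` with `g(0) = 0` and `g'(0) ≠ 0`. -/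
def HasHeight {k : Type*} [Field k] (F : FormalGroup k) (p : ℕ) [Fact p.Prime] [CharP k p]
    (h : ℕ) : Prop :=
  ∃ g : PowerSeries k, PowerSeries.constantCoeff g = 0 ∧ PowerSeries.coeff 1 g ≠ 0 ∧
    F.nSeries p = g.subst (PowerSeries.X ^ (p ^ h) : PowerSeries k)

end FormalGroup

/-! Where `2 = ν = 0` the cubic becomes `y² + y = x³`, or `z + z² = x³` in the chart `y = 1`. The
line through `(a, z(a))` and `(b, z(b))` has slope `l = (a² + ab + b²) / (1 + z(a) + z(b))`. This
form has a unit denominator, so it makes sense for `a = b` too. In characteristic two the third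
intersection has `x = l² + a + b`. Negation is `[x : 1 : z] ↦ [x : 1 + z : z]`, so the formal sum is
`x / (1 + z)` at the third point.

For `a ≠ b`, `formalPoint_add` identifies this series with addition in the group of points over the
fraction field. As a formal point determines its parameter (`formalPoint_injective`), associativity
and uniqueness of the law follow from the group of points.

On the diagonal `l = a²`, and the third point is `(a⁴, z(a)⁴) = (a⁴, z(a⁴))`. Hence `[2](x) = x⁴ /
(1 + z(x⁴)) = g(x⁴)` with `g = x / (1 + z(x))`, which gives both the height and the leading term
(`formalAdd_self`). There is no 2-torsion because `P = -P` forces `z = 0`. -/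

namespace MvPowerSeries

section

variable {σ k : Type*} [Field k]

theorem two_eq_zero_of_charP [CharP k 2] : (2 : MvPowerSeries σ k) = 0 := by
  have h := congrArg (C (σ := σ)) (CharTwo.two_eq_zero (R := k))
  rwa [map_ofNat, map_zero] at h

theorem coeff_single_one_mul {R : Type*} [CommSemiring R] (i : σ) (a b : MvPowerSeries σ R) :
    coeff (Finsupp.single i 1) (a * b) =
      coeff (Finsupp.single i 1) a * constantCoeff b
        + constantCoeff a * coeff (Finsupp.single i 1) b := by
  classical
  rw [coeff_mul, Finsupp.antidiagonal_single, Finset.sum_map,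
    Finset.Nat.sum_antidiagonal_eq_sum_range_succ_mk]
  simp [Finset.sum_range_succ, add_comm]

end

end MvPowerSeries

/-! ### Chord construction on `y² + y = x³` with power series coordinates. -/

namespace WeierstrassCurve

/-- The Weierstrass cubic `y² + y = x³`. -/
def cubicTwo (R : Type*) [CommRing R] : WeierstrassCurve R where
  a₁ := 0
  a₂ := 0
  a₃ := 1
  a₄ := 0
  a₆ := 0

namespace cubicTwo

open MvPowerSeries

variable {k : Type*} [Field k] {σ τ : Type*}

/-- The expansion `z(t)` on the cubic `y² + y = x³` at a power series `t`. -/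
noncomputable def zAt (t : MvPowerSeries σ k) : MvPowerSeries σ k :=
  (cubicTwo k).zExpansion.subst t

theorem constantCoeff_zAt {t : MvPowerSeries σ k} (ht : constantCoeff t = 0) :
    constantCoeff (zAt t) = 0 :=
  PowerSeries.constantCoeff_subst_eq_zero ht _ (cubicTwo k).constantCoeff_zExpansion

theorem zAt_add_sq {t : MvPowerSeries σ k} (ht : constantCoeff t = 0) :
    zAt t + zAt t ^ 2 = t ^ 3 := by
  have h := (cubicTwo k).subst_zExpansion ht
  rw [← zAt] at h
  simp only [cubicTwo, map_zero, map_one] at h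
  linear_combination h

/-- The difference of two solutions is killed by `1 + w + zAt t`, which has constant term 1 and so
is nonzero in a domain. -/
theorem eq_zAt {t w : MvPowerSeries σ k} (ht : constantCoeff t = 0)
    (hw : constantCoeff w = 0) (h : w + w ^ 2 = t ^ 3) : w = zAt t := by
  have h0 : (w - zAt t) * (1 + w + zAt t) = 0 := by
    linear_combination h - zAt_add_sq ht
  refine sub_eq_zero.mp ((mul_eq_zero.mp h0).resolve_right fun h1 => ?_)
  simpa [hw, constantCoeff_zAt ht] using congrArg constantCoeff h1

/-- The slope of the line through `(a, z(a))` and `(b, z(b))` in the chart `y = 1`. -/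
noncomputable def slope (a b : MvPowerSeries σ k) : MvPowerSeries σ k :=
  (a ^ 2 + a * b + b ^ 2) * (1 + zAt a + zAt b)⁻¹

/-- The `x`-coordinate of the third point on the line through `(a, z(a))` and `(b, z(b))`. -/
noncomputable def thirdX (a b : MvPowerSeries σ k) : MvPowerSeries σ k :=
  slope a b ^ 2 + a + b

/-- The `z`-coordinate of the third point on the line through `(a, z(a))` and `(b, z(b))`. -/
noncomputable def thirdZ (a b : MvPowerSeries σ k) : MvPowerSeries σ k :=
  slope a b * (thirdX a b + a) + zAt a

/-- The formal sum of `a` and `b` on the cubic `y² + y = x³`. -/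
noncomputable def formalAdd (a b : MvPowerSeries σ k) : MvPowerSeries σ k :=
  thirdX a b * (1 + thirdZ a b)⁻¹

section

variable {a b : MvPowerSeries σ k} (ha : constantCoeff a = 0) (hb : constantCoeff b = 0)
include ha hb

theorem slope_mul : slope a b * (1 + zAt a + zAt b) = a ^ 2 + a * b + b ^ 2 := by
  rw [slope, mul_assoc, MvPowerSeries.inv_mul_cancel, mul_one]
  simp [constantCoeff_zAt ha, constantCoeff_zAt hb]

theorem constantCoeff_slope : constantCoeff (slope a b) = 0 := by
  simp [slope, ha, hb]

theorem constantCoeff_thirdX : constantCoeff (thirdX a b) = 0 := by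
  simp [thirdX, ha, hb, constantCoeff_slope ha hb]

theorem constantCoeff_thirdZ : constantCoeff (thirdZ a b) = 0 := by
  simp [thirdZ, constantCoeff_zAt ha, constantCoeff_slope ha hb]

theorem constantCoeff_formalAdd : constantCoeff (formalAdd a b) = 0 := by
  simp [formalAdd, constantCoeff_thirdX ha hb]

theorem inv_mul_one_add_thirdZ : (1 + thirdZ a b)⁻¹ * (1 + thirdZ a b) = 1 := by
  rw [MvPowerSeries.inv_mul_cancel]
  simp [constantCoeff_thirdZ ha hb]

theorem formalAdd_mul : formalAdd a b * (1 + thirdZ a b) = thirdX a b := by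
  rw [formalAdd, mul_assoc, inv_mul_one_add_thirdZ ha hb, mul_one]

section Map

variable (φ : MvPowerSeries σ k →+* MvPowerSeries τ k)
  (hφ : ∀ t, constantCoeff t = 0 → constantCoeff (φ t) = 0)
include hφ

-- Each series of the construction is pinned down by a polynomial equation, so any ring homomorphism
-- preserving vanishing constant terms commutes with it; no continuity is needed.
omit hb in
theorem map_zAt : φ (zAt a) = zAt (φ a) := by
  refine eq_zAt (hφ _ ha) (hφ _ (constantCoeff_zAt ha)) ?_
  rw [← map_pow, ← map_add, zAt_add_sq ha, map_pow]

theorem map_slope : φ (slope a b) = slope (φ a) (φ b) := by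
  have h := congrArg φ (slope_mul ha hb)
  simp only [map_mul, map_add, map_pow, map_one, map_zAt ha φ hφ, map_zAt hb φ hφ] at h
  have h1 : (1 + zAt (φ a) + zAt (φ b)) ≠ 0 := fun h1 => by
    simpa [constantCoeff_zAt (hφ a ha), constantCoeff_zAt (hφ b hb)] using
      congrArg constantCoeff h1
  exact mul_right_cancel₀ h1 (h.trans (slope_mul (hφ a ha) (hφ b hb)).symm)

theorem map_formalAdd : φ (formalAdd a b) = formalAdd (φ a) (φ b) := by
  have hX : φ (thirdX a b) = thirdX (φ a) (φ b) := by
    simp only [thirdX, map_add, map_pow, map_slope ha hb φ hφ]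
  have hZ : φ (thirdZ a b) = thirdZ (φ a) (φ b) := by
    simp only [thirdZ, map_add, map_mul, map_slope ha hb φ hφ, map_zAt ha φ hφ, hX]
  have h := congrArg φ (formalAdd_mul ha hb)
  simp only [map_mul, map_add, map_one, hX, hZ] at h
  have h1 : (1 + thirdZ (φ a) (φ b)) ≠ 0 := fun h1 => by
    simpa [constantCoeff_thirdZ (hφ a ha) (hφ b hb)] using congrArg constantCoeff h1
  exact mul_right_cancel₀ h1 (h.trans (formalAdd_mul (hφ a ha) (hφ b hb)).symm)

end Map

variable [CharP k 2]

/-- This is the difference quotient: subtracting the curve equations at `a` and `b` factors as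
`(z(a) - z(b))(1 + z(a) + z(b)) = a³ - b³`, and signs disappear in characteristic two. -/
theorem slope_mul_add : slope a b * (a + b) = zAt a + zAt b := by
  have h1 : (1 + zAt a + zAt b) ≠ 0 := fun h1 => by
    simpa [constantCoeff_zAt ha, constantCoeff_zAt hb] using congrArg constantCoeff h1
  refine mul_right_cancel₀ h1 ?_
  linear_combination (a + b) * slope_mul ha hb - zAt_add_sq ha - zAt_add_sq hb
    + (a ^ 2 * b + a * b ^ 2 - zAt a * zAt b) * two_eq_zero_of_charP (σ := σ) (k := k)

theorem thirdZ_add_sq : thirdZ a b + thirdZ a b ^ 2 = thirdX a b ^ 3 := by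
  have h2 := two_eq_zero_of_charP (σ := σ) (k := k)
  have hs := slope_mul ha hb
  have hd := slope_mul_add ha hb
  have hz := zAt_add_sq ha
  -- Eliminating `zAt b` leaves a relation between the slope, `a` and `b` alone; with the curve
  -- equation at `a` it suffices.
  have hq : slope a b + slope a b ^ 2 * (a + b) = a ^ 2 + a * b + b ^ 2 := by
    linear_combination hs + slope a b * hd
  rw [thirdZ, thirdX]
  generalize slope a b = l at *
  generalize zAt a = s at *
  clear hs hd
  grind

/-- The negative of the third point, rescaled to `y = 1`, still satisfies `z + z² = x³`, so
uniqueness of the expansion applies. -/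
theorem zAt_formalAdd : zAt (formalAdd a b) = thirdZ a b * (1 + thirdZ a b)⁻¹ := by
  have h2 := two_eq_zero_of_charP (σ := σ) (k := k)
  have hi := inv_mul_one_add_thirdZ ha hb
  have h := thirdZ_add_sq ha hb
  refine (eq_zAt (constantCoeff_formalAdd ha hb) ?_ ?_).symm
  · simp [constantCoeff_thirdZ ha hb]
  rw [formalAdd]
  generalize (1 + thirdZ a b)⁻¹ = i at *
  generalize thirdZ a b = s at *
  generalize thirdX a b = t at *
  grind

end

end cubicTwo

end WeierstrassCurve

/-! ### Comparison with the group of points over the fraction field. -/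

namespace WeierstrassCurve

open MvPowerSeries
open scoped WeierstrassCurve.Projective

variable {k : Type*} [Field k] {σ : Type*}

/-- Both representatives have `y = 1`, which forces the projective scaling factor to be 1. -/
theorem formalPoint_injective (W : WeierstrassCurve k) {a b : MvPowerSeries σ k}
    (ha : constantCoeff a = 0) (hb : constantCoeff b = 0)
    (h : W.formalPoint a ha = W.formalPoint b hb) : a = b := by
  have h' := Quotient.exact (congrArg Projective.Point.point h)
  obtain ⟨u, hu⟩ := h'
  have h1 := congrFun hu 1
  have h0 := congrFun hu 0
  have hu1 : (u : PowerSeriesFrac k σ) = 1 := by simpa [Units.smul_def] using h1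
  refine IsFractionRing.injective (MvPowerSeries σ k) (PowerSeriesFrac k σ) ?_
  simpa [Units.smul_def, hu1] using h0.symm

namespace cubicTwo

theorem formalPoint_add [CharP k 2] {a b : MvPowerSeries σ k}
    (ha : constantCoeff a = 0) (hb : constantCoeff b = 0) (hab : a ≠ b) :
    (cubicTwo k).formalPoint a ha + (cubicTwo k).formalPoint b hb =
      (cubicTwo k).formalPoint (formalAdd a b) (constantCoeff_formalAdd ha hb) := by
  have hne : ¬ (![algebraMap _ (PowerSeriesFrac k σ) a, 1,
        algebraMap _ (PowerSeriesFrac k σ) (zAt a)] : Fin 3 → PowerSeriesFrac k σ) ≈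
      ![algebraMap _ (PowerSeriesFrac k σ) b, 1, algebraMap _ (PowerSeriesFrac k σ) (zAt b)] :=
    fun h => hab ((cubicTwo k).formalPoint_injective ha hb
      (Projective.Point.ext (Quotient.sound h)))
  refine Projective.Point.ext ?_
  rw [Projective.Point.add_point]
  refine (Projective.addMap_eq _ _).trans ?_
  refine (congrArg _ (Projective.add_of_not_equiv hne)).trans ?_
  refine Quotient.sound ?_
  have h2 := two_eq_zero_of_charP (σ := σ) (k := k)
  have hs := slope_mul_add ha hb
  have hza := zAt_add_sq ha
  have hzb := zAt_add_sq hb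
  have hi := inv_mul_one_add_thirdZ ha hb
  have hiZ : (1 + thirdZ a b) ≠ 0 := fun h0 => by simp [h0] at hi
  have hD : a + b ≠ 0 := fun h0 => hab (by linear_combination h0 - b * h2)
  -- This is the scaling factor between the two representatives: `(a + b)³` comes from the
  -- denominator-free chord formulas, `1 + thirdZ a b` from normalising `y` after negation.
  have hu : algebraMap _ (PowerSeriesFrac k σ) ((a + b) ^ 3 * (1 + thirdZ a b)) ≠ 0 :=
    (map_ne_zero_iff _ (IsFractionRing.injective _ _)).mpr (mul_ne_zero (pow_ne_zero 3 hD) hiZ)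
  have hF := formalAdd_mul ha hb
  have hX : (cubicTwo (MvPowerSeries σ k)).toProjective.addX ![a, 1, zAt a] ![b, 1, zAt b] =
      (a + b) ^ 3 * (1 + thirdZ a b) * formalAdd a b := by
    have h : (cubicTwo (MvPowerSeries σ k)).toProjective.addX ![a, 1, zAt a] ![b, 1, zAt b] =
        (a + b) ^ 3 * thirdX a b := by
      simp [Projective.addX, cubicTwo, thirdX]
      generalize slope a b = l at *
      generalize zAt a = s at *
      generalize zAt b = t at *
      clear hF hi hiZ hu hne
      grind
    linear_combination h - (a + b) ^ 3 * hF
  have hZ : (cubicTwo (MvPowerSeries σ k)).toProjective.addZ ![a, 1, zAt a] ![b, 1, zAt b] =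
      (a + b) ^ 3 * thirdZ a b := by
    simp [Projective.addZ, cubicTwo, thirdX, thirdZ]
    generalize slope a b = l at *
    generalize zAt a = s at *
    generalize zAt b = t at *
    clear hF hi hiZ hu hne
    grind
  have hY : (cubicTwo (MvPowerSeries σ k)).toProjective.addY ![a, 1, zAt a] ![b, 1, zAt b] =
      (a + b) ^ 3 * (1 + thirdZ a b) := by
    have h : (cubicTwo (MvPowerSeries σ k)).toProjective.negAddY ![a, 1, zAt a] ![b, 1, zAt b] =
        (a + b) ^ 3 := by
      simp [Projective.negAddY, cubicTwo]
      generalize zAt a = s at *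
      generalize zAt b = t at *
      clear hF hi hiZ hu hne hX hZ
      grind
    rw [Projective.addY, Projective.negY_eq, h, hZ]
    simp only [cubicTwo]
    linear_combination -(a + b) ^ 3 * (1 + thirdZ a b) * h2
  have hmap : (cubicTwo k).baseChange (PowerSeriesFrac k σ) =
      (cubicTwo (MvPowerSeries σ k)).map (algebraMap _ (PowerSeriesFrac k σ)) := by
    simp [cubicTwo, baseChange, WeierstrassCurve.map]
  have hcomp (t : MvPowerSeries σ k) : (![algebraMap _ (PowerSeriesFrac k σ) t, 1,
      algebraMap _ (PowerSeriesFrac k σ) (zAt t)] : Fin 3 → PowerSeriesFrac k σ) =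
      algebraMap _ (PowerSeriesFrac k σ) ∘ ![t, 1, zAt t] := by
    rw [Projective.comp_fin3, map_one]
  refine ⟨Units.mk0 _ hu, ?_⟩
  have hzF : (a + b) ^ 3 * (1 + thirdZ a b) * zAt (formalAdd a b) = (a + b) ^ 3 * thirdZ a b := by
    rw [zAt_formalAdd ha hb]
    linear_combination (a + b) ^ 3 * thirdZ a b * hi
  change _ • (![algebraMap _ (PowerSeriesFrac k σ) _, 1,
    algebraMap _ (PowerSeriesFrac k σ) (zAt _)] : Fin 3 → PowerSeriesFrac k σ) =
    Projective.addXYZ _ _ _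
  rw [hmap, hcomp, hcomp a, hcomp b, Projective.map_addXYZ, Projective.addXYZ, hX, hY, hZ, ← hzF]
  funext i
  fin_cases i <;> simp [Units.smul_def]

/-- Substitution is a ring homomorphism, so `map_formalAdd` applies. Since `a = b` is allowed,
doubling can be read off from the law even though the chord comparison excludes it. -/
theorem formalAdd_X_subst {a b : MvPowerSeries σ k} (ha : constantCoeff a = 0)
    (hb : constantCoeff b = 0) :
    (formalAdd (X (0 : Fin 2)) (X 1) : MvPowerSeries (Fin 2) k).subst ![a, b] =
      formalAdd a b := by
  have hc : ∀ i, constantCoeff ((![a, b] : Fin 2 → MvPowerSeries σ k) i) = 0 := fun i => by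
    fin_cases i <;> simp [ha, hb]
  have hs : HasSubst (![a, b] : Fin 2 → MvPowerSeries σ k) := hasSubst_of_constantCoeff_zero hc
  have h := map_formalAdd (constantCoeff_X (0 : Fin 2)) (constantCoeff_X (1 : Fin 2))
    (substAlgHom (R := k) hs : MvPowerSeries (Fin 2) k →+* MvPowerSeries σ k) fun t ht => by
      simpa using constantCoeff_subst_eq_zero hs hc ht
  simpa [subst_X hs] using h

/-- The square of the slope has no linear term, and dividing by a series with constant term 1 does
not change the linear part of a series without constant term. -/
theorem coeff_single_formalAdd (i : σ) {a b : MvPowerSeries σ k} (ha : constantCoeff a = 0)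
    (hb : constantCoeff b = 0) :
    coeff (Finsupp.single i 1) (formalAdd a b) =
      coeff (Finsupp.single i 1) a + coeff (Finsupp.single i 1) b := by
  have h := congrArg (coeff (Finsupp.single i 1)) (formalAdd_mul ha hb)
  rw [coeff_single_one_mul, constantCoeff_formalAdd ha hb, zero_mul, map_add,
    constantCoeff_thirdZ ha hb, map_one, add_zero, add_zero, mul_one] at h
  rw [h, thirdX, map_add, map_add, pow_two, coeff_single_one_mul, constantCoeff_slope ha hb,
    mul_zero, zero_mul, add_zero, zero_add]

/-! ### The formal group law, its doubling series, and supersingularity. -/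

section

variable [CharP k 2]

/-- Associativity is inherited from the group of points. The four sums involved are all of distinct
points, as linear coefficients show. -/
theorem formalAdd_assoc_X :
    formalAdd (formalAdd (X 0) (X 1)) (X 2) =
      (formalAdd (X 0) (formalAdd (X 1) (X 2)) : MvPowerSeries (Fin 3) k) := by
  have h0 := constantCoeff_X (R := k) (0 : Fin 3)
  have h1 := constantCoeff_X (R := k) (1 : Fin 3)
  have h2 := constantCoeff_X (R := k) (2 : Fin 3)
  have h01 := constantCoeff_formalAdd h0 h1
  have h12 := constantCoeff_formalAdd h1 h2
  have hne (i j : Fin 3) (hij : i ≠ j) : (X i : MvPowerSeries (Fin 3) k) ≠ X j :=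
    fun h => hij (X_inj.mp h)
  have hne₁ : formalAdd (X 0) (X 1) ≠ (X 2 : MvPowerSeries (Fin 3) k) := fun h => by
    have := congrArg (coeff (Finsupp.single 2 1)) h
    rw [coeff_single_formalAdd 2 h0 h1] at this
    simp [coeff_index_single_X] at this
  have hne₂ : (X 0 : MvPowerSeries (Fin 3) k) ≠ formalAdd (X 1) (X 2) := fun h => by
    have := congrArg (coeff (Finsupp.single 0 1)) h
    rw [coeff_single_formalAdd 0 h1 h2] at this
    simp [coeff_index_single_X] at this
  refine (cubicTwo k).formalPoint_injective (constantCoeff_formalAdd h01 h2)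
    (constantCoeff_formalAdd h0 h12) ?_
  rw [← formalPoint_add h01 h2 hne₁, ← formalPoint_add h0 h12 hne₂,
    ← formalPoint_add h0 h1 (hne 0 1 (by decide)), ← formalPoint_add h1 h2 (hne 1 2 (by decide)),
    add_assoc]

/-- The formal group law of the cubic `y² + y = x³` in characteristic two. -/
noncomputable def formalGroup (k : Type*) [Field k] [CharP k 2] : FormalGroup k where
  toPowerSeries := formalAdd (X 0) (X 1)
  zero_constantCoeff := constantCoeff_formalAdd (constantCoeff_X 0) (constantCoeff_X 1)
  lin_coeff_X := by
    rw [coeff_single_formalAdd 0 (constantCoeff_X 0) (constantCoeff_X 1)]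
    simp [coeff_index_single_X]
  lin_coeff_Y := by
    rw [coeff_single_formalAdd 1 (constantCoeff_X 0) (constantCoeff_X 1)]
    simp [coeff_index_single_X]
  assoc := by
    have h0 := constantCoeff_X (R := k) (0 : Fin 3)
    have h1 := constantCoeff_X (R := k) (1 : Fin 3)
    have h2 := constantCoeff_X (R := k) (2 : Fin 3)
    rw [formalAdd_X_subst h0 h1, formalAdd_X_subst h1 h2,
      formalAdd_X_subst (constantCoeff_formalAdd h0 h1) h2,
      formalAdd_X_subst h0 (constantCoeff_formalAdd h1 h2), formalAdd_assoc_X]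

theorem isFormalGroupLaw_iff (G : FormalGroup k) :
    (cubicTwo k).IsFormalGroupLaw G ↔ G = formalGroup k := by
  have hne : (X (0 : Fin 2) : MvPowerSeries (Fin 2) k) ≠ X 1 := fun h => by
    simpa using X_inj.mp h
  have h := formalPoint_add (constantCoeff_X (R := k) (0 : Fin 2)) (constantCoeff_X 1) hne
  rw [IsFormalGroupLaw, h]
  refine ⟨fun hG => ?_, fun hG => ?_⟩
  · exact FormalGroup.ext (formalPoint_injective _ _ _ hG).symm
  · subst hG
    rfl

theorem formalAdd_self {a : MvPowerSeries σ k} (ha : constantCoeff a = 0) :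
    formalAdd a a = a ^ 4 * (1 + zAt (a ^ 4))⁻¹ := by
  have h2 := two_eq_zero_of_charP (σ := σ) (k := k)
  have hl : slope a a = a ^ 2 := by
    have h := slope_mul ha ha
    linear_combination h + (a ^ 2 - slope a a * zAt a) * h2
  have hX : thirdX a a = a ^ 4 := by
    rw [thirdX, hl]
    linear_combination a * h2
  have hz := zAt_add_sq ha
  -- The fourth power is a Frobenius iterate and the equation has coefficients in the prime field.
  have h4 : zAt a ^ 4 = zAt (a ^ 4) := by
    refine eq_zAt (by simp [ha]) (by simp [constantCoeff_zAt ha]) ?_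
    generalize zAt a = s at *
    grind
  have hZ : thirdZ a a = zAt (a ^ 4) := by
    rw [thirdZ, hl, hX, ← h4]
    generalize zAt a = s at *
    grind
  rw [formalAdd, hX, hZ]

theorem nSeries_two :
    (formalGroup k).nSeries 2 = PowerSeries.X ^ 4 * (1 + zAt (PowerSeries.X ^ 4))⁻¹ := by
  rw [FormalGroup.nSeries, two_nsmul, FormalGroup.add_apply]
  have hX : MvPowerSeries.constantCoeff (PowerSeries.X : PowerSeries k) = 0 := constantCoeff_X _
  exact (formalAdd_X_subst hX hX).trans (formalAdd_self hX)

theorem hasHeight_two : (formalGroup k).HasHeight 2 2 := by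
  have hX : MvPowerSeries.constantCoeff (PowerSeries.X : PowerSeries k) = 0 := constantCoeff_X _
  have hX4 : MvPowerSeries.constantCoeff (PowerSeries.X ^ 4 : PowerSeries k) = 0 := by
    rw [map_pow, hX, zero_pow four_ne_zero]
  have hs : PowerSeries.HasSubst (PowerSeries.X ^ 4 : PowerSeries k) :=
    PowerSeries.HasSubst.X_pow four_ne_zero
  have hu : constantCoeff (1 + zAt (PowerSeries.X : PowerSeries k)) = 1 := by
    rw [map_add, map_one, constantCoeff_zAt hX, add_zero]
  have hu4 : constantCoeff (1 + zAt (PowerSeries.X ^ 4 : PowerSeries k)) = 1 := by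
    rw [map_add, map_one, constantCoeff_zAt hX4, add_zero]
  -- The witness is `[2](x) = x⁴ / (1 + z(x⁴))` with `x⁴` replaced by `x`.
  refine ⟨PowerSeries.X * (1 + zAt (PowerSeries.X : PowerSeries k))⁻¹, ?_, ?_, ?_⟩
  · rw [map_mul, PowerSeries.constantCoeff_X, zero_mul]
  · have h1 : PowerSeries.constantCoeff ((1 + zAt (PowerSeries.X : PowerSeries k))⁻¹) = 1 := by
      refine (constantCoeff_inv _).trans ?_
      rw [hu, inv_one]
    rw [← PowerSeries.coeff_zero_eq_constantCoeff_apply] at h1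
    rw [(PowerSeries.coeff_succ_X_mul 0 _).trans h1]
    exact one_ne_zero
  · have hz : PowerSeries.substAlgHom (R := k) hs (zAt (PowerSeries.X : PowerSeries k)) =
        zAt (PowerSeries.X ^ 4 : PowerSeries k) := by
      refine (map_zAt hX (PowerSeries.substAlgHom (R := k) hs :
        PowerSeries k →+* PowerSeries k) fun t ht => ?_).trans ?_
      · simpa [PowerSeries.coe_substAlgHom] using
          PowerSeries.constantCoeff_subst_eq_zero hX4 t ht
      · simp [PowerSeries.coe_substAlgHom, PowerSeries.subst_X hs]
    have hi := congrArg (PowerSeries.substAlgHom (R := k) hs)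
      (MvPowerSeries.inv_mul_cancel (1 + zAt (PowerSeries.X : PowerSeries k))
        (by rw [hu]; exact one_ne_zero))
    have hi' : PowerSeries.substAlgHom (R := k) hs (1 + zAt (PowerSeries.X : PowerSeries k))⁻¹ *
        (1 + zAt (PowerSeries.X ^ 4 : PowerSeries k)) = 1 := by
      have hu' := map_add (PowerSeries.substAlgHom (R := k) hs) 1
        (zAt (PowerSeries.X : PowerSeries k))
      rw [map_one] at hu'
      rw [← hz, ← hu', ← map_mul]
      exact hi.trans (map_one _)
    have h1 := MvPowerSeries.inv_mul_cancel (1 + zAt (PowerSeries.X ^ 4 : PowerSeries k))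
      (by rw [hu4]; exact one_ne_zero)
    have h2 : PowerSeries.substAlgHom (R := k) hs (1 + zAt (PowerSeries.X : PowerSeries k))⁻¹ =
        (1 + zAt (PowerSeries.X ^ 4 : PowerSeries k))⁻¹ :=
      mul_right_cancel₀ (right_ne_zero_of_mul_eq_one h1) (hi'.trans h1.symm)
    rw [nSeries_two, ← h2]
    change _ = PowerSeries.subst (PowerSeries.X ^ 4 : PowerSeries k) _
    rw [← PowerSeries.coe_substAlgHom hs, map_mul, PowerSeries.substAlgHom_X]

theorem X_pow_five_dvd_nSeries_two_sub :
    PowerSeries.X ^ 5 ∣ (formalGroup k).nSeries 2 - PowerSeries.X ^ 4 := by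
  have hX4 : MvPowerSeries.constantCoeff (PowerSeries.X ^ 4 : PowerSeries k) = 0 := by
    rw [map_pow]
    exact (congrArg (· ^ 4) (constantCoeff_X _)).trans (zero_pow four_ne_zero)
  have hu4 : constantCoeff (1 + zAt (PowerSeries.X ^ 4 : PowerSeries k)) = 1 := by
    rw [map_add, map_one, constantCoeff_zAt hX4, add_zero]
  have h : PowerSeries.X ∣ ((1 + zAt (PowerSeries.X ^ 4 : PowerSeries k))⁻¹ - 1 :
      PowerSeries k) := by
    rw [PowerSeries.X_dvd_iff, map_sub, map_one, sub_eq_zero]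
    refine (constantCoeff_inv _).trans ?_
    rw [hu4, inv_one]
  rw [nSeries_two]
  obtain ⟨c, hc⟩ := h
  exact ⟨c, by linear_combination PowerSeries.X ^ 4 * hc⟩

theorem isSupersingular : (cubicTwo k).IsSupersingular 2 := by
  refine ⟨⟨?_⟩, fun P hP => ?_⟩
  · have h2 := CharTwo.two_eq_zero (R := k)
    -- Over any ring the discriminant is `-27 = 1 - 14 * 2`.
    have : (cubicTwo k).Δ = 1 := by
      simp [Δ, b₂, b₄, b₆, b₈, cubicTwo]
      linear_combination -14 * h2
    simp [this]
  · have h2 := CharTwo.two_eq_zero (R := AlgebraicClosure k)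
    rw [two_nsmul, add_eq_zero_iff_eq_neg] at hP
    obtain @⟨⟨v⟩, hns⟩ := P
    have hns' := (Projective.nonsingularLift_iff v).mp hns
    have hY := Projective.Y_eq_of_equiv (Quotient.exact (congrArg Projective.Point.point hP))
    -- Comparing `y / z` for `P` and `-P` gives `z = 0` or `2y + z = 0`, and the latter is again `z
    -- = 0`. The only point with `z = 0` is the origin.
    have hz : v 2 = 0 := by
      simp [Projective.neg, Projective.negY, cubicTwo, baseChange] at hY
      refine hY.elim (fun h => ?_) id
      linear_combination h - v 1 * h2
    exact Projective.Point.ext (Quotient.sound (Projective.equiv_zero_of_Z_eq_zero hns' hz))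

end

end cubicTwo

end WeierstrassCurve

/-! ### The base `B/(2, ν)` is the field with four elements. -/

open Polynomial in
/-- The field with four elements, as the ring of primitive cube roots of unity over `𝔽₂`. -/
noncomputable abbrev CubeRootRingModTwo : Type :=
  AdjoinRoot (1 + X + X ^ 2 : (ZMod 2)[X])

open Polynomial in
theorem natDegree_cubeRootPolynomial : (1 + X + X ^ 2 : (ZMod 2)[X]).natDegree = 2 := by
  compute_degree!

open Polynomial in
theorem irreducible_cubeRootPolynomial : Irreducible (1 + X + X ^ 2 : (ZMod 2)[X]) := by
  refine Polynomial.irreducible_of_degree_le_three_of_not_isRoot ?_ ?_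
  · rw [natDegree_cubeRootPolynomial]
    decide
  · intro x
    rw [IsRoot.def]
    simp only [eval_add, eval_one, eval_X, eval_pow]
    revert x
    decide

open Polynomial in
theorem cubeRootRingModTwo_ringEquiv : Nonempty (CubeRootRingModTwo ≃+* GaloisField 2 2) := by
  have hf := irreducible_cubeRootPolynomial
  have : Fact (Irreducible (1 + X + X ^ 2 : (ZMod 2)[X])) := ⟨hf⟩
  let pb := AdjoinRoot.powerBasis hf.ne_zero
  have : Module.Finite (ZMod 2) CubeRootRingModTwo := pb.finite
  have : Finite CubeRootRingModTwo := Module.finite_of_finite (ZMod 2)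
  have := Fintype.ofFinite CubeRootRingModTwo
  have := Fintype.ofFinite (GaloisField 2 2)
  refine ⟨FiniteField.ringEquivOfCardEq ?_⟩
  rw [← Nat.card_eq_fintype_card, ← Nat.card_eq_fintype_card, GaloisField.card 2 2 two_ne_zero,
    Module.natCard_eq_pow_finrank (K := ZMod 2), pb.finrank]
  simp [pb, natDegree_cubeRootPolynomial]

theorem cubeRootRingModTwo_two : (2 : CubeRootRingModTwo) = 0 := by
  have h := congrArg (AdjoinRoot.of (1 + Polynomial.X + Polynomial.X ^ 2 : Polynomial (ZMod 2)))
    (show (2 : ZMod 2) = 0 from rfl)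
  rwa [map_ofNat, map_zero] at h

theorem cubeRootRingModTwo_isUnit_three : IsUnit (Int.castRingHom CubeRootRingModTwo 3) := by
  have h := cubeRootRingModTwo_two
  have : Int.castRingHom CubeRootRingModTwo 3 = 1 := by
    simp
    linear_combination h
  rw [this]
  exact isUnit_one

/-- Reduction of `A` modulo two. -/
noncomputable def cubeRootRingReduction : CubeRootRing →+* CubeRootRingModTwo :=
  AdjoinRoot.lift (IsLocalization.Away.lift (3 : ℤ) cubeRootRingModTwo_isUnit_three)
    (AdjoinRoot.root _) (by
      have h := AdjoinRoot.eval₂_root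
        (1 + Polynomial.X + Polynomial.X ^ 2 : Polynomial (ZMod 2))
      simpa using h)

theorem isUnit_reduction_X_pow_three_sub_one :
    IsUnit (Polynomial.eval₂RingHom cubeRootRingReduction 0
      ((Polynomial.X : Polynomial CubeRootRing) ^ 3 - 1)) := by
  simp

/-- Reduction of `B` modulo two and `ν`. -/
noncomputable def levelThreeBaseReduction : LevelThreeBase →+* CubeRootRingModTwo :=
  IsLocalization.Away.lift ((Polynomial.X : Polynomial CubeRootRing) ^ 3 - 1)
    isUnit_reduction_X_pow_three_sub_one

/-- The map `B/(2, ν) → 𝔽₄`. -/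
noncomputable def specialFibreBaseHom : SpecialFibreBase →+* CubeRootRingModTwo :=
  Ideal.Quotient.lift _ levelThreeBaseReduction fun a ha => by
    refine (Ideal.span_le (I := RingHom.ker levelThreeBaseReduction)).mpr ?_ ha
    rintro _ (rfl | rfl)
    · exact (map_ofNat levelThreeBaseReduction 2).trans cubeRootRingModTwo_two
    · simp [levelThreeBaseReduction, levelThreeNu]

theorem specialFibreBase_two : (2 : SpecialFibreBase) = 0 :=
  (map_ofNat (Ideal.Quotient.mk (Ideal.span {2, levelThreeNu})) 2).symm.trans
    (Ideal.Quotient.eq_zero_iff_mem.mpr (Ideal.subset_span (by simp)))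

theorem mk_levelThreeNu : Ideal.Quotient.mk (Ideal.span {2, levelThreeNu}) levelThreeNu = 0 :=
  Ideal.Quotient.eq_zero_iff_mem.mpr (Ideal.subset_span (by simp))

/-- The structure map `A → B/(2, ν)`. -/
noncomputable def cubeRootRingToSpecialFibre : CubeRootRing →+* SpecialFibreBase :=
  (Ideal.Quotient.mk _).comp ((algebraMap (Polynomial CubeRootRing) LevelThreeBase).comp
    Polynomial.C)

/-- The structure map `𝔽₂ → B/(2, ν)`. -/
noncomputable def specialFibreBaseOfZMod : ZMod 2 →+* SpecialFibreBase :=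
  ZMod.castHom (ringChar.dvd specialFibreBase_two) SpecialFibreBase

/-- The map `𝔽₄ → B/(2, ν)`. -/
noncomputable def specialFibreBaseInvHom : CubeRootRingModTwo →+* SpecialFibreBase :=
  AdjoinRoot.lift (specialFibreBaseOfZMod)
    (cubeRootRingToSpecialFibre (AdjoinRoot.root _)) (by
      have h := congrArg cubeRootRingToSpecialFibre (AdjoinRoot.eval₂_root
        (1 + Polynomial.X + Polynomial.X ^ 2 : Polynomial (Localization.Away (3 : ℤ))))
      simpa using h)

theorem specialFibreBaseInvHom_root :
    specialFibreBaseInvHom (AdjoinRoot.root _) = cubeRootRingToSpecialFibre (AdjoinRoot.root _) :=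
  AdjoinRoot.lift_root _

theorem specialFibreBaseHom_mk_algebraMap (p : Polynomial CubeRootRing) :
    specialFibreBaseHom (Ideal.Quotient.mk _ (algebraMap _ LevelThreeBase p)) =
      p.eval₂ cubeRootRingReduction 0 :=
  IsLocalization.Away.lift_eq _ isUnit_reduction_X_pow_three_sub_one p

theorem specialFibreBaseHom_root :
    specialFibreBaseHom (cubeRootRingToSpecialFibre (AdjoinRoot.root _)) = AdjoinRoot.root _ :=
  (specialFibreBaseHom_mk_algebraMap _).trans
    ((Polynomial.eval₂_C _ _).trans (AdjoinRoot.lift_root _))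

/-- Modulo `(2, ν)` the inverted elements `3` and `ν³ - 1` are already units, so only `𝔽₂[ω]/(1 + ω
+ ω²)` remains. The two maps are inverse because both composites fix the generators `ω` and `ν = 0`.
-/
theorem specialFibreBase_ringEquiv : Nonempty (SpecialFibreBase ≃+* GaloisField 2 2) := by
  obtain ⟨e⟩ := cubeRootRingModTwo_ringEquiv
  refine ⟨(RingEquiv.ofRingHom specialFibreBaseHom specialFibreBaseInvHom ?_ ?_).trans e⟩
  · refine AdjoinRoot.ringHom_ext (RingHom.ext_zmod _ _) ?_
    rw [RingHom.comp_apply, specialFibreBaseInvHom_root, specialFibreBaseHom_root, RingHom.id_apply]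
  · refine Ideal.Quotient.ringHom_ext (IsLocalization.ringHom_ext
      (Submonoid.powers ((Polynomial.X : Polynomial CubeRootRing) ^ 3 - 1))
      (Polynomial.ringHom_ext' (AdjoinRoot.ringHom_ext
        (IsLocalization.ringHom_ext (Submonoid.powers (3 : ℤ)) (RingHom.ext_int _ _)) ?_) ?_))
    · exact (congrArg specialFibreBaseInvHom specialFibreBaseHom_root).trans
        specialFibreBaseInvHom_root
    · refine (congrArg specialFibreBaseInvHom
        (specialFibreBaseHom_mk_algebraMap Polynomial.X)).trans ?_
      rw [Polynomial.eval₂_X, map_zero]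
      exact mk_levelThreeNu.symm

theorem mainTheorem8 :
    Nonempty (SpecialFibreBase ≃+* GaloisField 2 2) ∧
    ∀ e : SpecialFibreBase ≃+* GaloisField 2 2,
      (specialFibreCurve.map (e : SpecialFibreBase →+* GaloisField 2 2)).IsSupersingular 2 ∧
      ∃ F : FormalGroup (GaloisField 2 2),
        (∀ G : FormalGroup (GaloisField 2 2),
          (specialFibreCurve.map (e : SpecialFibreBase →+* GaloisField 2 2)).IsFormalGroupLaw G ↔
            G = F) ∧
        F.HasHeight 2 2 ∧
        PowerSeries.X ^ 5 ∣ F.nSeries 2 - PowerSeries.X ^ 4 := by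
  refine ⟨specialFibreBase_ringEquiv, fun e => ?_⟩
  have hν := mk_levelThreeNu
  have h2 := CharTwo.two_eq_zero (R := GaloisField 2 2)
  -- The coefficients reduce to `a₁ = 0` and `a₃ = -1 = 1`, which lie in the prime field, so the
  -- choice of `e` does not matter.
  have hmap : specialFibreCurve.map (e : SpecialFibreBase →+* GaloisField 2 2) =
      WeierstrassCurve.cubicTwo (GaloisField 2 2) := by
    ext
    · simp [specialFibreCurve, levelThreeCurve, WeierstrassCurve.cubicTwo, hν]
    · simp [specialFibreCurve, levelThreeCurve, WeierstrassCurve.cubicTwo]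
    · simp [specialFibreCurve, levelThreeCurve, WeierstrassCurve.cubicTwo, hν]
      linear_combination -h2
    · simp [specialFibreCurve, levelThreeCurve, WeierstrassCurve.cubicTwo]
    · simp [specialFibreCurve, levelThreeCurve, WeierstrassCurve.cubicTwo]
  rw [hmap]
  exact ⟨WeierstrassCurve.cubicTwo.isSupersingular, WeierstrassCurve.cubicTwo.formalGroup _,
    WeierstrassCurve.cubicTwo.isFormalGroupLaw_iff, WeierstrassCurve.cubicTwo.hasHeight_two,
    WeierstrassCurve.cubicTwo.X_pow_five_dvd_nSeries_two_sub⟩
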